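/- Let $\omega$ be a free ultrafilter on $\mathbb{N}$ and let $(n_k)_{k\in\mathbb{N}}$ be a sequence of positive integers with $\lim_{k}n_k=\infty$. On $M_m(\mathbb{C})$ let $Tr(A)=\frac1m\sum_i a_{ii}$ be the normalized trace and $\|A\|_2=\sqrt{\frac1m\sum_{i,j}|a_{ij}|^2}$ the trace norm. Let $l^\infty(\mathbb{N},M_{n_k})$ be the $*$-algebra of sequences $(x_k)_k$, $x_k\in M_{n_k}(\mathbb{C})$, that are bounded in the operator norm, let $\mathcal{N}_\omega=\{(x_k)_k\in l^\infty(\mathbb{N},M_{n_k}):\lim_{k\to\omega}\|x_k\|_2=0\}$, and let $\Pi_{k\to\omega}M_{n_k}=l^\infty(\mathbb{N},M_{n_k})/\mathcal{N}_\omega$ be the ultraproduct of matrices, a unital $*$-algebra with the trace $Tr\big(\Pi_{k\to\omega}x_k\big)=\lim_{k\to\omega}Tr(x_k)$, where $\Pi_{k\to\omega}x_k$ denotes the class of $(x_k)_k$. Let $u,v\in\Pi_{k\to\omega}M_{n_k}$ be unitaries, i.e. $u^*u=uu^*=1$ and $v^*v=vv^*=1$. Then there exists a unitary $w\in\Pi_{k\to\omega}M_{n_k}$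 with $v=wuw^*$ if and only if $Tr(u^j)=Tr(v^j)$ for every $j\in\mathbb{Z}$. -/

import Mathlib

open Filter Topology
open scoped ENNReal

namespace MatUltra

noncomputable section

open scoped Matrix.Norms.L2Operator

/-- The normalized trace `Tr(A) = (1/m) ∑ᵢ aᵢᵢ` on `m × m` complex matrices. -/
def normTr {m : ℕ} (A : Matrix (Fin m) (Fin m) ℂ) : ℂ := (1 / (m : ℂ)) * ∑ i, A i i

/-- The trace norm `‖A‖₂ = √((1/m) ∑ᵢⱼ |aᵢⱼ|²)` on `m × m` complex matrices. -/
def traceNorm {m : ℕ} (A : Matrix (Fin m) (Fin m) ℂ) : ℝ :=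
  Real.sqrt ((1 / (m : ℝ)) * ∑ i, ∑ j, ‖A i j‖ ^ 2)

section Matrices

variable {m : ℕ}

theorem traceNorm_nonneg (A : Matrix (Fin m) (Fin m) ℂ) : 0 ≤ traceNorm A := Real.sqrt_nonneg _

theorem traceNorm_zero : traceNorm (0 : Matrix (Fin m) (Fin m) ℂ) = 0 := by simp [traceNorm]

theorem traceNorm_star (A : Matrix (Fin m) (Fin m) ℂ) : traceNorm (star A) = traceNorm A := by
  unfold traceNorm
  rw [Finset.sum_comm]
  simp [Matrix.star_apply]

theorem traceNorm_eq (A : Matrix (Fin m) (Fin m) ℂ) : traceNorm A =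
    Real.sqrt (1 / (m : ℝ)) *
      ‖(WithLp.toLp 2 (fun p : Fin m × Fin m => A p.1 p.2) : EuclideanSpace ℂ (Fin m × Fin m))‖ := by
  rw [traceNorm, EuclideanSpace.norm_eq, ← Real.sqrt_mul (by positivity), Fintype.sum_prod_type]

theorem traceNorm_add_le (A B : Matrix (Fin m) (Fin m) ℂ) :
    traceNorm (A + B) ≤ traceNorm A + traceNorm B := by
  simp only [traceNorm_eq, ← mul_add]
  refine mul_le_mul_of_nonneg_left ?_ (Real.sqrt_nonneg _)
  exact norm_add_le
    (WithLp.toLp 2 (fun p : Fin m × Fin m => A p.1 p.2) : EuclideanSpace ℂ (Fin m × Fin m))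
    (WithLp.toLp 2 (fun p : Fin m × Fin m => B p.1 p.2))

theorem traceNorm_mul_le (A B : Matrix (Fin m) (Fin m) ℂ) :
    traceNorm (A * B) ≤ ‖A‖ * traceNorm B := by
  have hA : 0 ≤ ‖A‖ := norm_nonneg A
  unfold traceNorm
  rw [← Real.sqrt_sq hA, ← Real.sqrt_mul (by positivity)]
  apply Real.sqrt_le_sqrt
  rw [Finset.sum_comm, Finset.sum_comm (f := fun i j => ‖B i j‖ ^ 2), mul_left_comm]
  refine mul_le_mul_of_nonneg_left ?_ (by positivity)
  rw [Finset.mul_sum]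
  refine Finset.sum_le_sum fun j _ => ?_
  have h := Matrix.l2_opNorm_mulVec A (WithLp.toLp 2 (fun i => B i j))
  have h2 := mul_self_le_mul_self (norm_nonneg _) h
  rw [← sq, mul_mul_mul_comm, ← sq, ← sq, EuclideanSpace.norm_sq_eq,
    EuclideanSpace.norm_sq_eq] at h2
  exact h2

theorem traceNorm_mul_le' (A B : Matrix (Fin m) (Fin m) ℂ) :
    traceNorm (A * B) ≤ traceNorm A * ‖B‖ := by
  rw [← traceNorm_star, star_mul, mul_comm, ← traceNorm_star A, ← norm_star B]
  exact traceNorm_mul_le _ _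

theorem normTr_sub (A B : Matrix (Fin m) (Fin m) ℂ) :
    normTr (A - B) = normTr A - normTr B := by
  simp [normTr, mul_sub]

theorem norm_normTr_le_traceNorm (A : Matrix (Fin m) (Fin m) ℂ) :
    ‖normTr A‖ ≤ traceNorm A := by
  rcases Nat.eq_zero_or_pos m with rfl | hm
  · simp [normTr, traceNorm]
  have hm' : (0 : ℝ) < m := by exact_mod_cast hm
  apply Real.le_sqrt_of_sq_le
  have h1 : ‖normTr A‖ ≤ (1 / (m : ℝ)) * ∑ i, ‖A i i‖ := by
    rw [normTr, norm_mul]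
    gcongr
    · simp
    · exact norm_sum_le _ _
  have h2 : (∑ i, ‖A i i‖) ^ 2 ≤ (m : ℝ) * ∑ i, ‖A i i‖ ^ 2 := by
    simpa using sq_sum_le_card_mul_sum_sq (s := Finset.univ) (f := fun i : Fin m => ‖A i i‖)
  have h3 : ∑ i, ‖A i i‖ ^ 2 ≤ ∑ i, ∑ j, ‖A i j‖ ^ 2 :=
    Finset.sum_le_sum fun i _ =>
      Finset.single_le_sum (f := fun j => ‖A i j‖ ^ 2) (fun _ _ => by positivity)
        (Finset.mem_univ i)
  calc ‖normTr A‖ ^ 2 ≤ ((1 / (m : ℝ)) * ∑ i, ‖A i i‖) ^ 2 := by gcongr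
    _ = (1 / (m : ℝ)) ^ 2 * (∑ i, ‖A i i‖) ^ 2 := by ring
    _ ≤ (1 / (m : ℝ)) ^ 2 * ((m : ℝ) * ∑ i, ‖A i i‖ ^ 2) := by gcongr
    _ = (1 / (m : ℝ)) * ∑ i, ‖A i i‖ ^ 2 := by field_simp
    _ ≤ _ := by gcongr

theorem norm_normTr_le_norm (A : Matrix (Fin m) (Fin m) ℂ) : ‖normTr A‖ ≤ ‖A‖ := by
  have h1 : traceNorm (1 : Matrix (Fin m) (Fin m) ℂ) ≤ 1 := by
    rw [traceNorm, Real.sqrt_le_iff, one_pow]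
    refine ⟨zero_le_one, ?_⟩
    have : ∀ i : Fin m, ∑ j, ‖(1 : Matrix (Fin m) (Fin m) ℂ) i j‖ ^ 2 = 1 := by
      intro i
      rw [Finset.sum_eq_single i] <;> simp +contextual [eq_comm]
    simp only [this]
    simpa using inv_mul_le_one (a := (m : ℝ))
  calc ‖normTr A‖ ≤ traceNorm (A * 1) := by simpa using norm_normTr_le_traceNorm A
    _ ≤ ‖A‖ * traceNorm 1 := traceNorm_mul_le _ _
    _ ≤ ‖A‖ * 1 := mul_le_mul_of_nonneg_left h1 (norm_nonneg A)
    _ = ‖A‖ := mul_one _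

end Matrices

/-- `l^∞(ℕ, M_{n_k})`: sequences `x_k ∈ M_{n_k}(ℂ)` that are bounded in the operator norm,
with the pointwise `*`-algebra operations. -/
abbrev BoundedSeq (n : ℕ → ℕ+) : Type :=
  lp (fun k => Matrix (Fin (n k)) (Fin (n k)) ℂ) ∞

variable (ω : Ultrafilter ℕ) (n : ℕ → ℕ+)

/-- `𝒩_ω`: the bounded sequences `x` with `lim_{k → ω} ‖x_k‖₂ = 0`. -/
def nullIdeal : Ideal (BoundedSeq n) where
  carrier := {x | Tendsto (fun k => traceNorm (x k)) (ω : Filter ℕ) (𝓝 0)}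
  zero_mem' := by simp [traceNorm_zero]
  add_mem' {x y} hx hy := by
    refine squeeze_zero (fun k => traceNorm_nonneg _) (fun k => traceNorm_add_le _ _) ?_
    simpa using Tendsto.add hx hy
  smul_mem' c x hx := by
    refine squeeze_zero (g := fun k => ‖c‖ * traceNorm (x k)) (fun k => traceNorm_nonneg _)
      (fun k => (traceNorm_mul_le _ _).trans ?_) ?_
    · exact mul_le_mul_of_nonneg_right (lp.norm_apply_le_norm (by simp) c k) (traceNorm_nonneg _)
    · simpa using Tendsto.const_mul ‖c‖ hx

theorem mem_nullIdeal {x : BoundedSeq n} :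
    x ∈ nullIdeal ω n ↔ Tendsto (fun k => traceNorm (x k)) (ω : Filter ℕ) (𝓝 0) := Iff.rfl

instance : (nullIdeal ω n).IsTwoSided where
  mul_mem_of_left {x} c hx := by
    refine squeeze_zero (g := fun k => traceNorm (x k) * ‖c‖) (fun k => traceNorm_nonneg _)
      (fun k => (traceNorm_mul_le' _ _).trans ?_) ?_
    · exact mul_le_mul_of_nonneg_left (lp.norm_apply_le_norm (by simp) c k) (traceNorm_nonneg _)
    · simpa using Tendsto.mul_const ‖c‖ hx

theorem star_mem_nullIdeal {x : BoundedSeq n} (hx : x ∈ nullIdeal ω n) :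
    star x ∈ nullIdeal ω n := by
  rw [mem_nullIdeal] at hx ⊢
  simpa [lp.star_apply, traceNorm_star] using hx

/-- The ultraproduct `Π_{k→ω} M_{n_k} = l^∞(ℕ, M_{n_k}) / 𝒩_ω`. -/
def MatrixUltraproduct : Type := BoundedSeq n ⧸ nullIdeal ω n

instance : Ring (MatrixUltraproduct ω n) := 
  Ideal.Quotient.ring (nullIdeal ω n)

instance : Algebra ℂ (MatrixUltraproduct ω n) :=
  
  Ideal.Quotient.algebra ℂ (I := nullIdeal ω n)

/-- The class `Π_{k→ω} x_k` of a bounded sequence `x`. -/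
def MatrixUltraproduct.mk : BoundedSeq n →ₐ[ℂ] MatrixUltraproduct ω n :=
  Ideal.Quotient.mkₐ ℂ (nullIdeal ω n)

theorem MatrixUltraproduct.mk_surjective : Function.Surjective (MatrixUltraproduct.mk ω n) :=
  Ideal.Quotient.mk_surjective

theorem MatrixUltraproduct.mk_eq_mk {x y : BoundedSeq n} :
    MatrixUltraproduct.mk ω n x = MatrixUltraproduct.mk ω n y ↔ x - y ∈ nullIdeal ω n :=
  Ideal.Quotient.eq

/-- The involution of the ultraproduct, `(Π_{k→ω} x_k)* = Π_{k→ω} x_k*`. -/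
instance : Star (MatrixUltraproduct ω n) where
  star := Quotient.lift (fun x : BoundedSeq n => MatrixUltraproduct.mk ω n (star x)) (by
    intro x y h
    have h' : MatrixUltraproduct.mk ω n x = MatrixUltraproduct.mk ω n y := Quotient.sound h
    rw [MatrixUltraproduct.mk_eq_mk] at h' ⊢
    rw [← star_sub]
    exact star_mem_nullIdeal ω n h')

theorem MatrixUltraproduct.star_mk (x : BoundedSeq n) :
    star (MatrixUltraproduct.mk ω n x) = MatrixUltraproduct.mk ω n (star x) := rfl

instance : StarRing (MatrixUltraproduct ω n) where
  star_involutive a := by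
    obtain ⟨x, rfl⟩ := MatrixUltraproduct.mk_surjective ω n a
    simp only [MatrixUltraproduct.star_mk, star_star]
  star_mul a b := by
    obtain ⟨x, rfl⟩ := MatrixUltraproduct.mk_surjective ω n a
    obtain ⟨y, rfl⟩ := MatrixUltraproduct.mk_surjective ω n b
    simp only [MatrixUltraproduct.star_mk, ← map_mul]
    exact congrArg (MatrixUltraproduct.mk ω n) (star_mul x y)
  star_add a b := by
    obtain ⟨x, rfl⟩ := MatrixUltraproduct.mk_surjective ω n a
    obtain ⟨y, rfl⟩ := MatrixUltraproduct.mk_surjective ω n b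
    simp only [MatrixUltraproduct.star_mk, ← map_add, star_add]

instance : StarModule ℂ (MatrixUltraproduct ω n) where
  star_smul c a := by
    obtain ⟨x, rfl⟩ := MatrixUltraproduct.mk_surjective ω n a
    simp only [MatrixUltraproduct.star_mk, ← map_smul, star_smul]

/-- The trace of the ultraproduct, `Tr(Π_{k→ω} x_k) = lim_{k→ω} Tr(x_k)`
(the limit exists: see `MatrixUltraproduct.tendsto_trace`). -/
def MatrixUltraproduct.trace : MatrixUltraproduct ω n → ℂ :=
  Quotient.lift (fun x : BoundedSeq n => limUnder (ω : Filter ℕ) fun k => normTr (x k)) (by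
    intro x y h
    have h' : MatrixUltraproduct.mk ω n x = MatrixUltraproduct.mk ω n y := Quotient.sound h
    rw [MatrixUltraproduct.mk_eq_mk, mem_nullIdeal] at h'
    have h0 : Tendsto (fun k => normTr (x k) - normTr (y k)) (ω : Filter ℕ) (𝓝 0) := by
      refine squeeze_zero_norm (fun k => ?_) h'
      rw [← normTr_sub]
      exact norm_normTr_le_traceNorm _
    have key : ∀ l : ℂ, Tendsto (fun k => normTr (x k)) (ω : Filter ℕ) (𝓝 l) ↔
        Tendsto (fun k => normTr (y k)) (ω : Filter ℕ) (𝓝 l) := fun l =>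
      ⟨fun hx => by simpa using hx.sub h0, fun hy => by simpa using h0.add hy⟩
    simp only [limUnder, lim]
    congr 1
    funext l
    exact propext (key l))

theorem MatrixUltraproduct.tendsto_trace (x : BoundedSeq n) :
    Tendsto (fun k => normTr (x k)) (ω : Filter ℕ)
      (𝓝 (MatrixUltraproduct.trace ω n (MatrixUltraproduct.mk ω n x))) := by
  obtain ⟨l, -, hl⟩ := (isCompact_closedBall (0 : ℂ) ‖x‖).ultrafilter_le_nhds
    (ω.map fun k => normTr (x k)) (by
      rw [le_principal_iff]
      refine Filter.Eventually.of_forall (f := (ω : Filter ℕ)) fun k => ?_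
      rw [mem_closedBall_zero_iff]
      exact (norm_normTr_le_norm _).trans (lp.norm_apply_le_norm (by simp) x k))
  exact tendsto_nhds_limUnder ⟨l, hl⟩

end

end MatUltra

/-! The trace is invariant under conjugation, which gives one direction. For the converse, lift `u`
and `v` to sequences of unitary matrices (`exists_unitary_lift`) and diagonalize each term. The
traces of powers are the moments of the eigenvalue distributions, so for each fixed moment the
difference tends to `0` along `ω`. What remains is quantitative and finite-dimensional: two families
of `m` points on the circle with nearby moments can be matched by a permutation with small mean
square distance. Conjugating by that permutation, between the two eigenbases, gives
`exists_unitary_traceNorm_sub_conj_le`.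

The matching is a transport problem. Translates of the Fejér kernel by `N`-th roots of unity form a
partition of unity on the circle into fuzzy cells. The mass in each cell is a combination of
moments, so the two families have nearly equal cell masses, and most mass can be moved within its
own cell (`exists_doublyStochastic_cost_le`). Birkhoff's theorem turns the resulting doubly
stochastic plan into a permutation. The permutation minimizes the cost, so it does not depend on
`N`, and no diagonal choice of `N` along `ω` is needed. -/

namespace MatUltra

noncomputable section

/-! ### Finite optimal transport: couplings, cell masses and Birkhoff's theorem. -/

section Transport

variable {ι α : Type*} [Fintype ι] [DecidableEq ι] [Fintype α]

/-- A linear cost on doubly stochastic matrices is dominated from below at a permutation. -/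
theorem exists_perm_sum_le_of_mem_doublyStochastic (c : ι → ι → ℝ) {D : Matrix ι ι ℝ}
    (hD : D ∈ doublyStochastic ℝ ι) :
    ∃ σ : Equiv.Perm ι, ∑ i, c i (σ i) ≤ ∑ i, ∑ j, D i j * c i j := by
  -- By Birkhoff the cost of `D` is a weighted average of permutation costs, and the least of these
  -- is at most the average.
  obtain ⟨w, hw0, hw1, rfl⟩ := exists_eq_sum_perm_of_mem_doublyStochastic hD
  have h : ∑ i, ∑ j, (∑ σ, w σ • σ.permMatrix ℝ) i j * c i j = ∑ σ, w σ * ∑ i, c i (σ i) := by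
    simp only [Matrix.sum_apply, Matrix.smul_apply, Finset.sum_mul, smul_eq_mul, Finset.mul_sum]
    simp only [Finset.sum_comm (s := (Finset.univ : Finset ι))
      (t := (Finset.univ : Finset (Equiv.Perm ι)))]
    refine Finset.sum_congr rfl fun σ _ => Finset.sum_congr rfl fun i _ => ?_
    simp [PEquiv.toMatrix_apply, Equiv.toPEquiv_apply]
  rw [h]
  obtain ⟨σ, -, hσ⟩ := Finset.exists_min_image (Finset.univ : Finset (Equiv.Perm ι))
    (fun σ => ∑ i, c i (σ i)) ⟨1, Finset.mem_univ _⟩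
  refine ⟨σ, ?_⟩
  calc ∑ i, c i (σ i) = ∑ τ, w τ * ∑ i, c i (σ i) := by rw [← Finset.sum_mul, hw1, one_mul]
    _ ≤ _ := Finset.sum_le_sum fun τ _ => mul_le_mul_of_nonneg_left (hσ τ (Finset.mem_univ _)) (hw0 τ)

/-- A doubly substochastic matrix is dominated by a doubly stochastic one. -/
theorem exists_doublyStochastic_ge (T : Matrix ι ι ℝ) (hT : ∀ i j, 0 ≤ T i j)
    (hr : ∀ i, ∑ j, T i j ≤ 1) (hc : ∀ j, ∑ i, T i j ≤ 1) :
    ∃ D ∈ doublyStochastic ℝ ι, ∀ i j, T i j ≤ D i j := by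
  -- The row deficits and the column deficits both sum to `s`, so adding the rank-one matrix of
  -- their products divided by `s` repairs all rows and columns. If `s = 0`, every deficit vanishes
  -- and division by zero adds nothing.
  set s : ℝ := ∑ i, (1 - ∑ j, T i j) with hs
  have hs' : s = ∑ j, (1 - ∑ i, T i j) := by
    rw [hs, Finset.sum_sub_distrib, Finset.sum_sub_distrib, Finset.sum_comm]
  have hs0 : 0 ≤ s := Finset.sum_nonneg fun i _ => sub_nonneg.2 (hr i)
  have key : ∀ i j, 0 ≤ (1 - ∑ j, T i j) * (1 - ∑ i, T i j) / s := fun i j =>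
    div_nonneg (mul_nonneg (sub_nonneg.2 (hr i)) (sub_nonneg.2 (hc j))) hs0
  refine ⟨Matrix.of fun i j => T i j + (1 - ∑ j, T i j) * (1 - ∑ i, T i j) / s, ?_, fun i j => ?_⟩
  · rw [mem_doublyStochastic_iff_sum]
    refine ⟨fun i j => add_nonneg (hT i j) (key i j), fun i => ?_, fun j => ?_⟩
    · simp only [Matrix.of_apply, Finset.sum_add_distrib]
      rw [← Finset.sum_div, ← Finset.mul_sum, ← hs']
      rcases eq_or_ne s 0 with h0 | h0
      · have := (Finset.sum_eq_zero_iff_of_nonneg fun i _ => sub_nonneg.2 (hr i)).1 h0 i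
          (Finset.mem_univ _)
        simp [h0]; linarith
      · rw [mul_div_cancel_right₀ _ h0]; ring
    · simp only [Matrix.of_apply, Finset.sum_add_distrib]
      rw [← Finset.sum_div, ← Finset.sum_mul, ← hs]
      rcases eq_or_ne s 0 with h0 | h0
      · have := (Finset.sum_eq_zero_iff_of_nonneg fun i _ => sub_nonneg.2 (hc i)).1
          (hs'.symm.trans h0) j (Finset.mem_univ _)
        simp [h0]; linarith
      · rw [mul_div_cancel_left₀ _ h0]; ring
  · simpa using key i j

/-- Two families of points, spread over finitely many cells `a` by partitions of unity `f` and `g`,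
can be matched at a cost controlled by the spread and by the discrepancy of the cell masses. -/
theorem exists_doublyStochastic_cost_le (f g x y : α → ι → ℝ) (c : ι → ι → ℝ) {C : ℝ}
    (hf : ∀ a i, 0 ≤ f a i) (hg : ∀ a i, 0 ≤ g a i)
    (hf1 : ∀ i, ∑ a, f a i = 1) (hg1 : ∀ i, ∑ a, g a i = 1)
    (hx : ∀ a i, 0 ≤ x a i) (hy : ∀ a i, 0 ≤ y a i)
    (hcC : ∀ i j, c i j ≤ C) (hC : 0 ≤ C) (hc : ∀ a i j, c i j ≤ x a i + y a j) :
    ∃ D ∈ doublyStochastic ℝ ι, ∑ i, ∑ j, D i j * c i j ≤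
      ∑ i, ∑ a, f a i * x a i + ∑ j, ∑ a, g a j * y a j
        + C * ∑ a, |∑ i, f a i - ∑ j, g a j| := by
  set p : α → ℝ := fun a => ∑ i, f a i with hp
  set q : α → ℝ := fun a => ∑ i, g a i with hq
  have hp0 : ∀ a, 0 ≤ p a := fun a => Finset.sum_nonneg fun i _ => hf a i
  have hq0 : ∀ a, 0 ≤ q a := fun a => Finset.sum_nonneg fun i _ => hg a i
  -- Inside cell `a` use the product coupling, scaled so that it carries mass `min (p a) (q a)`.
  -- Cells of zero mass get `t a = 0`.
  set t : α → ℝ := fun a => min (p a) (q a) / (p a * q a) with ht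
  have ht0 : ∀ a, 0 ≤ t a := fun a =>
    div_nonneg (le_min (hp0 a) (hq0 a)) (mul_nonneg (hp0 a) (hq0 a))
  have htq : ∀ a, t a * q a ≤ 1 := by
    intro a
    rcases (hp0 a).eq_or_lt with h | h
    · simp [ht, ← h]
    rcases (hq0 a).eq_or_lt with h' | h'
    · simp [← h']
    have : t a * q a = min (p a) (q a) / p a := by simp only [ht]; field_simp
    rw [this, div_le_one h]; exact min_le_left _ _
  have htp : ∀ a, t a * p a ≤ 1 := by
    intro a
    rcases (hp0 a).eq_or_lt with h | h
    · simp [← h]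
    rcases (hq0 a).eq_or_lt with h' | h'
    · simp [ht, ← h']
    have : t a * p a = min (p a) (q a) / q a := by simp only [ht]; field_simp
    rw [this, div_le_one h']; exact min_le_right _ _
  have htpq : ∀ a, t a * p a * q a = min (p a) (q a) := by
    intro a
    rcases (hp0 a).eq_or_lt with h | h
    · simp [← h, hq0 a]
    rcases (hq0 a).eq_or_lt with h' | h'
    · simp [← h', hp0 a]
    simp only [ht]; field_simp
  set T : Matrix ι ι ℝ := Matrix.of fun i j => ∑ a, f a i * g a j * t a with hT
  have hT0 : ∀ i j, 0 ≤ T i j := fun i j =>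
    Finset.sum_nonneg fun a _ => mul_nonneg (mul_nonneg (hf a i) (hg a j)) (ht0 a)
  have hrow : ∀ i, ∑ j, T i j = ∑ a, f a i * (t a * q a) := by
    intro i
    simp only [hT, Matrix.of_apply]
    rw [Finset.sum_comm]
    refine Finset.sum_congr rfl fun a _ => ?_
    simp only [hq, Finset.mul_sum]
    exact Finset.sum_congr rfl fun j _ => by ring
  have hcol : ∀ j, ∑ i, T i j = ∑ a, g a j * (t a * p a) := by
    intro j
    simp only [hT, Matrix.of_apply]
    rw [Finset.sum_comm]
    refine Finset.sum_congr rfl fun a _ => ?_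
    simp only [hp, Finset.mul_sum]
    exact Finset.sum_congr rfl fun j _ => by ring
  obtain ⟨D, hD, hTD⟩ := exists_doublyStochastic_ge T hT0
    (fun i => by
      rw [hrow, ← hf1 i]
      exact Finset.sum_le_sum fun a _ => mul_le_of_le_one_right (hf a i) (htq a))
    (fun j => by
      rw [hcol, ← hg1 j]
      exact Finset.sum_le_sum fun a _ => mul_le_of_le_one_right (hg a j) (htp a))
  refine ⟨D, hD, ?_⟩
  have h1 : ∑ i, ∑ j, T i j * c i j ≤ ∑ i, ∑ a, f a i * x a i + ∑ j, ∑ a, g a j * y a j := by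
    calc ∑ i, ∑ j, T i j * c i j
        ≤ ∑ i, ∑ j, (∑ a, f a i * g a j * t a * x a i + ∑ a, f a i * g a j * t a * y a j) := by
          refine Finset.sum_le_sum fun i _ => Finset.sum_le_sum fun j _ => ?_
          rw [← Finset.sum_add_distrib, hT, Matrix.of_apply, Finset.sum_mul]
          refine Finset.sum_le_sum fun a _ => ?_
          rw [← mul_add]
          exact mul_le_mul_of_nonneg_left (hc a i j)
            (mul_nonneg (mul_nonneg (hf a i) (hg a j)) (ht0 a))
      _ = ∑ i, ∑ a, f a i * x a i * (t a * q a) + ∑ j, ∑ a, g a j * y a j * (t a * p a) := by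
          simp only [Finset.sum_add_distrib]
          congr 1
          · refine Finset.sum_congr rfl fun i _ => ?_
            rw [Finset.sum_comm]
            refine Finset.sum_congr rfl fun a _ => ?_
            simp only [hq, Finset.mul_sum]
            exact Finset.sum_congr rfl fun j _ => by ring
          · rw [Finset.sum_comm]
            refine Finset.sum_congr rfl fun j _ => ?_
            rw [Finset.sum_comm]
            refine Finset.sum_congr rfl fun a _ => ?_
            simp only [hp, Finset.mul_sum]
            exact Finset.sum_congr rfl fun i _ => by ring
      _ ≤ _ := by
          refine add_le_add ?_ ?_ <;>
            refine Finset.sum_le_sum fun i _ => Finset.sum_le_sum fun a _ => ?_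
          · exact mul_le_of_le_one_right (mul_nonneg (hf a i) (hx a i)) (htq a)
          · exact mul_le_of_le_one_right (mul_nonneg (hg a i) (hy a i)) (htp a)
  -- The mass not moved within a cell is `∑ (p - min p q)`; it is charged at the maximal cost `C`.
  have h2 : ∑ i, ∑ j, (D i j - T i j) ≤ ∑ a, |p a - q a| := by
    have e1 : ∑ i, ∑ j, D i j = ∑ a, p a := by
      simp only [sum_row_of_mem_doublyStochastic hD, hp]
      rw [Finset.sum_comm]
      simp only [hf1]
    have e2 : ∑ i, ∑ j, T i j = ∑ a, min (p a) (q a) := by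
      simp only [hrow]
      rw [Finset.sum_comm]
      refine Finset.sum_congr rfl fun a _ => ?_
      rw [← htpq, ← Finset.sum_mul]
      simp only [hp]; ring
    simp only [Finset.sum_sub_distrib, e1, e2]
    rw [← Finset.sum_sub_distrib]
    refine Finset.sum_le_sum fun a _ => ?_
    rcases le_total (p a) (q a) with h | h
    · simp [min_eq_left h]
    · rw [min_eq_right h]; exact le_abs_self _
  calc ∑ i, ∑ j, D i j * c i j
      = ∑ i, ∑ j, T i j * c i j + ∑ i, ∑ j, (D i j - T i j) * c i j := by
        simp only [← Finset.sum_add_distrib]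
        exact Finset.sum_congr rfl fun i _ => Finset.sum_congr rfl fun j _ => by ring
    _ ≤ _ + ∑ i, ∑ j, (D i j - T i j) * C :=
        add_le_add h1 (Finset.sum_le_sum fun i _ => Finset.sum_le_sum fun j _ =>
          mul_le_mul_of_nonneg_left (hcC i j) (sub_nonneg.2 (hTD i j)))
    _ ≤ _ := by
        simp only [← Finset.sum_mul]
        rw [mul_comm C]
        gcongr

end Transport

/-! ### The Fejér kernel as a partition of unity on the circle. -/

section Fejer

/-- The Fejér kernel `|∑_{j<N} zʲ|² / N²`. -/
def fejer (N : ℕ) (z : ℂ) : ℝ := ‖∑ j ∈ Finset.range N, z ^ j‖ ^ 2 / (N : ℝ) ^ 2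

theorem fejer_nonneg (N : ℕ) (z : ℂ) : 0 ≤ fejer N z := by unfold fejer; positivity

theorem fejer_eq_sum (N : ℕ) (z : ℂ) : (fejer N z : ℂ) =
    (∑ j ∈ Finset.range N, ∑ l ∈ Finset.range N, z ^ j * star z ^ l) / (N : ℂ) ^ 2 := by
  rw [fejer]
  push_cast
  rw [← Complex.mul_conj', map_sum, Finset.sum_mul_sum]
  simp

/-- The geometric sum telescopes to `z ^ N - 1`, of norm at most `2`. This concentration near `1`
makes the cells small on average. -/
theorem fejer_mul_le {N : ℕ} {z : ℂ} (hz : ‖z‖ = 1) :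
    fejer N z * ‖z - 1‖ ^ 2 ≤ 4 / (N : ℝ) ^ 2 := by
  rw [fejer, div_mul_eq_mul_div, ← mul_pow, ← norm_mul, geom_sum_mul]
  gcongr
  have : ‖z ^ N - 1‖ ≤ 2 := (norm_sub_le _ _).trans (by simp [hz]; norm_num)
  nlinarith [norm_nonneg (z ^ N - 1)]

variable {N : ℕ} {ζ : ℂ}

/-- Expanding the square, orthogonality of the characters of `ℤ/N` leaves only the `N` diagonal
terms, each equal to `N`. -/
theorem sum_fejer_mul_root (hN : N ≠ 0) (hζ : IsPrimitiveRoot ζ N) {z : ℂ} (hz : ‖z‖ = 1) :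
    ∑ a : Fin N, fejer N (z * ζ ^ (a : ℕ)) = 1 := by
  have hN' : (N : ℂ) ≠ 0 := by exact_mod_cast hN
  have hζ1 : ‖ζ‖ = 1 := hζ.norm'_eq_one hN
  have hζs : ζ * star ζ = 1 := by
    rw [Complex.star_def, Complex.mul_conj', hζ1]; simp
  have hzs : z * star z = 1 := by
    rw [Complex.star_def, Complex.mul_conj', hz]; simp
  have orth : ∀ j < N, ∀ l < N, ∑ a ∈ Finset.range N, (ζ ^ j * star ζ ^ l) ^ a =
      if j = l then (N : ℂ) else 0 := by
    intro j hj l hl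
    split_ifs with h
    · subst h
      rw [← mul_pow, hζs]
      simp
    · have h1 : ζ ^ j * star ζ ^ l ≠ 1 := by
        intro h1
        apply h
        apply hζ.pow_inj hj hl
        calc ζ ^ j = ζ ^ j * star ζ ^ l * ζ ^ l := by
              rw [mul_assoc, ← mul_pow, mul_comm (star ζ), hζs]; simp
          _ = ζ ^ l := by rw [h1, one_mul]
      have h2 : (ζ ^ j * star ζ ^ l) ^ N = 1 := by
        rw [mul_pow, ← pow_mul, ← pow_mul, mul_comm j, mul_comm l, pow_mul, pow_mul, hζ.pow_eq_one,
          ← star_pow, hζ.pow_eq_one]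
        simp
      have h3 := geom_sum_mul (ζ ^ j * star ζ ^ l) N
      rw [h2, sub_self] at h3
      exact (mul_eq_zero.1 h3).resolve_right (sub_ne_zero.2 h1)
  rw [Fin.sum_univ_eq_sum_range (fun a => fejer N (z * ζ ^ a))]
  apply Complex.ofReal_injective
  push_cast
  simp only [fejer_eq_sum]
  rw [← Finset.sum_div, Finset.sum_comm]
  have : ∀ j ∈ Finset.range N, ∑ a ∈ Finset.range N, ∑ l ∈ Finset.range N,
      (z * ζ ^ a) ^ j * star (z * ζ ^ a) ^ l = N := by
    intro j hj
    rw [Finset.mem_range] at hj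
    rw [Finset.sum_comm]
    calc _ = ∑ l ∈ Finset.range N, z ^ j * star z ^ l *
            ∑ a ∈ Finset.range N, (ζ ^ j * star ζ ^ l) ^ a := by
          refine Finset.sum_congr rfl fun l _ => ?_
          rw [Finset.mul_sum]
          refine Finset.sum_congr rfl fun a _ => ?_
          simp only [star_mul', star_pow, mul_pow, ← pow_mul]
          ring
      _ = ∑ l ∈ Finset.range N, if j = l then (N : ℂ) else 0 := by
          refine Finset.sum_congr rfl fun l hl => ?_
          rw [orth j hj l (Finset.mem_range.1 hl)]
          split_ifs with h
          · subst h
            rw [← mul_pow, hzs]; simp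
          · simp
      _ = N := by simp [hj]
  rw [Finset.sum_congr rfl this]
  simp only [Finset.sum_const, Finset.card_range, nsmul_eq_mul]
  field_simp

/-- The kernel is a polynomial in `z` and `star z`, so each cell mass is a combination of moments
whose coefficients have modulus `1 / N ^ 2`. -/
theorem abs_sum_fejer_sub_le {ι : Type*} [Fintype ι] (w : ℂ) (hw : ‖w‖ = 1) (lam mu : ι → ℂ) :
    |∑ i, fejer N (lam i * w) - ∑ i, fejer N (mu i * w)| ≤
      (∑ j ∈ Finset.range N, ∑ l ∈ Finset.range N,
        ‖∑ i, lam i ^ j * star (lam i) ^ l - ∑ i, mu i ^ j * star (mu i) ^ l‖) / (N : ℝ) ^ 2 := by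
  have key : ∀ κ : ι → ℂ, ((∑ i, fejer N (κ i * w) : ℝ) : ℂ) =
      (∑ j ∈ Finset.range N, ∑ l ∈ Finset.range N,
        w ^ j * star w ^ l * ∑ i, κ i ^ j * star (κ i) ^ l) / (N : ℂ) ^ 2 := by
    intro κ
    push_cast
    simp only [fejer_eq_sum]
    rw [← Finset.sum_div, Finset.sum_comm]
    congr 1
    refine Finset.sum_congr rfl fun j _ => ?_
    rw [Finset.sum_comm]
    refine Finset.sum_congr rfl fun l _ => ?_
    rw [Finset.mul_sum]
    refine Finset.sum_congr rfl fun i _ => ?_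
    simp only [star_mul', mul_pow]
    ring
  rw [← Real.norm_eq_abs, ← Complex.norm_real, Complex.ofReal_sub, key, key, ← sub_div, norm_div]
  simp only [norm_pow, Complex.norm_natCast]
  gcongr
  rw [← Finset.sum_sub_distrib]
  refine (norm_sum_le _ _).trans (Finset.sum_le_sum fun j _ => ?_)
  rw [← Finset.sum_sub_distrib]
  refine (norm_sum_le _ _).trans (Finset.sum_le_sum fun l _ => ?_)
  rw [← mul_sub, norm_mul]
  simp [hw]

end Fejer

/-! ### Matching points of the circle by their moments. -/

/-- Two families of points of the circle with nearby moments can be matched, on average, at small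
distance. The permutation does not depend on the number `N` of moments. -/
theorem exists_perm_sum_norm_sub_sq_le {ι : Type*} [Fintype ι] (lam mu : ι → ℂ)
    (hlam : ∀ i, ‖lam i‖ = 1) (hmu : ∀ i, ‖mu i‖ = 1) :
    ∃ σ : Equiv.Perm ι, ∀ N : ℕ, N ≠ 0 → ∑ i, ‖mu i - lam (σ i)‖ ^ 2 ≤
      16 * Fintype.card ι / N + 4 / N * ∑ j ∈ Finset.range N, ∑ l ∈ Finset.range N,
        ‖∑ i, lam i ^ j * star (lam i) ^ l - ∑ i, mu i ^ j * star (mu i) ^ l‖ := by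
  classical
  -- The optimal permutation is fixed before `N`; for each `N` it only has to beat the one produced
  -- below.
  obtain ⟨σ, -, hσ⟩ := Finset.exists_min_image (Finset.univ : Finset (Equiv.Perm ι))
    (fun σ => ∑ i, ‖mu i - lam (σ i)‖ ^ 2) ⟨1, Finset.mem_univ _⟩
  refine ⟨σ, fun N hN => ?_⟩
  have hN' : (0 : ℝ) < N := by exact_mod_cast Nat.pos_of_ne_zero hN
  set ζ : ℂ := Complex.exp (2 * Real.pi * Complex.I / N) with hζd
  have hζ : IsPrimitiveRoot ζ N := Complex.isPrimitiveRoot_exp N hN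
  have hζ1 : ∀ a : ℕ, ‖ζ ^ a‖ = 1 := fun a => by rw [norm_pow, hζ.norm'_eq_one hN, one_pow]
  -- Cell `a` is centred at the inverse of `ζ ^ a`. The cost splits through the centre by `(r + s)²
  -- ≤ 2r² + 2s²`, and `C = 4` is the squared diameter of the circle.
  obtain ⟨D, hD, hcost⟩ := exists_doublyStochastic_cost_le (α := Fin N) (C := 4)
    (fun a i => fejer N (mu i * ζ ^ (a : ℕ))) (fun a i => fejer N (lam i * ζ ^ (a : ℕ)))
    (fun a i => 2 * ‖mu i * ζ ^ (a : ℕ) - 1‖ ^ 2) (fun a i => 2 * ‖lam i * ζ ^ (a : ℕ) - 1‖ ^ 2)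
    (fun i j => ‖mu i - lam j‖ ^ 2)
    (fun _ _ => fejer_nonneg _ _) (fun _ _ => fejer_nonneg _ _)
    (fun i => sum_fejer_mul_root hN hζ (hmu i)) (fun i => sum_fejer_mul_root hN hζ (hlam i))
    (fun _ _ => by positivity) (fun _ _ => by positivity)
    (fun i j => by
      have : ‖mu i - lam j‖ ≤ 2 := (norm_sub_le _ _).trans (by rw [hmu, hlam]; norm_num)
      nlinarith [norm_nonneg (mu i - lam j)])
    (by norm_num)
    (fun a i j => by
      have h : ‖mu i - lam j‖ ≤ ‖mu i * ζ ^ (a : ℕ) - 1‖ + ‖lam j * ζ ^ (a : ℕ) - 1‖ := by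
        rw [← mul_one ‖mu i - lam j‖, ← hζ1 a, ← norm_mul]
        refine le_trans (le_of_eq ?_) (norm_sub_le _ _)
        congr 1; ring
      have h' := mul_self_le_mul_self (norm_nonneg _) h
      nlinarith [sq_nonneg (‖mu i * ζ ^ (a : ℕ) - 1‖ - ‖lam j * ζ ^ (a : ℕ) - 1‖)])
  obtain ⟨τ, hτ⟩ := exists_perm_sum_le_of_mem_doublyStochastic (fun i j => ‖mu i - lam j‖ ^ 2) hD
  refine (hσ τ (Finset.mem_univ _)).trans (hτ.trans (hcost.trans ?_))
  -- Each of the `N` cells contributes at most `2 * 4 / N ^ 2` per point, hence `8 / N` per point in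
  -- each family.
  have spread : ∀ κ : ι → ℂ, (∀ i, ‖κ i‖ = 1) → ∑ i, ∑ a : Fin N, fejer N (κ i * ζ ^ (a : ℕ)) *
      (2 * ‖κ i * ζ ^ (a : ℕ) - 1‖ ^ 2) ≤ (8 * Fintype.card ι / N : ℝ) := by
    intro κ hκ
    calc _ ≤ ∑ i : ι, ∑ a : Fin N, 2 * (4 / (N : ℝ) ^ 2) := by
          refine Finset.sum_le_sum fun i _ => Finset.sum_le_sum fun a _ => ?_
          rw [mul_left_comm]
          exact mul_le_mul_of_nonneg_left (fejer_mul_le (by rw [norm_mul, hκ, hζ1, one_mul]))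
            (by norm_num)
      _ = _ := by
          simp only [Finset.sum_const, Finset.card_univ, Fintype.card_fin, nsmul_eq_mul]
          field_simp
          norm_num [mul_assoc]
  have mass : ∑ a : Fin N, |∑ i, fejer N (mu i * ζ ^ (a : ℕ)) - ∑ i, fejer N (lam i * ζ ^ (a : ℕ))|
      ≤ (1 / N : ℝ) * ∑ j ∈ Finset.range N, ∑ l ∈ Finset.range N,
        ‖∑ i, lam i ^ j * star (lam i) ^ l - ∑ i, mu i ^ j * star (mu i) ^ l‖ := by
    set S : ℝ := ∑ j ∈ Finset.range N, ∑ l ∈ Finset.range N,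
      ‖∑ i, lam i ^ j * star (lam i) ^ l - ∑ i, mu i ^ j * star (mu i) ^ l‖
    calc _ ≤ ∑ _a : Fin N, S / (N : ℝ) ^ 2 := by
          refine Finset.sum_le_sum fun a _ => ?_
          rw [abs_sub_comm]
          exact abs_sum_fejer_sub_le _ (hζ1 a) lam mu
      _ = _ := by
          simp only [Finset.sum_const, Finset.card_univ, Fintype.card_fin, nsmul_eq_mul]
          field_simp
  have e : (16 * Fintype.card ι / N : ℝ) = 8 * Fintype.card ι / N + 8 * Fintype.card ι / N := by ring
  rw [e]
  refine add_le_add (add_le_add (spread mu hmu) (spread lam hlam)) ?_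
  calc _ ≤ _ := mul_le_mul_of_nonneg_left mass (by norm_num : (0 : ℝ) ≤ 4)
    _ = _ := by ring

open scoped Matrix.Norms.L2Operator

/-! ### Unitary matrices: polar part, diagonalization, approximate conjugacy. -/

section UnitaryMatrices

variable {m : ℕ}

theorem norm_le_one_of_mem_unitary {A : Matrix (Fin m) (Fin m) ℂ} (hA : A ∈ unitary (Matrix (Fin m) (Fin m) ℂ)) :
    ‖A‖ ≤ 1 := by
  have h := CStarRing.norm_star_mul_self (x := A)
  rw [(Unitary.mem_iff.1 hA).1] at h
  have h1 : ‖(1 : Matrix (Fin m) (Fin m) ℂ)‖ ≤ 1 := by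
    rcases Nat.eq_zero_or_pos m with rfl | hm
    · rw [Subsingleton.elim (1 : Matrix (Fin 0) (Fin 0) ℂ) 0]; simp
    · have : Nonempty (Fin m) := ⟨⟨0, hm⟩⟩
      exact CStarRing.norm_one.le
  nlinarith [norm_nonneg A]

theorem traceNorm_unitary_mul_mul_le {A B : Matrix (Fin m) (Fin m) ℂ}
    (hA : A ∈ unitary (Matrix (Fin m) (Fin m) ℂ)) (hB : B ∈ unitary (Matrix (Fin m) (Fin m) ℂ))
    (X : Matrix (Fin m) (Fin m) ℂ) : traceNorm (A * X * B) ≤ traceNorm X := by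
  calc traceNorm (A * X * B) ≤ traceNorm (A * X) * ‖B‖ := traceNorm_mul_le' _ _
    _ ≤ traceNorm (A * X) * 1 :=
        mul_le_mul_of_nonneg_left (norm_le_one_of_mem_unitary hB) (traceNorm_nonneg _)
    _ ≤ ‖A‖ * traceNorm X := by rw [mul_one]; exact traceNorm_mul_le _ _
    _ ≤ 1 * traceNorm X :=
        mul_le_mul_of_nonneg_right (norm_le_one_of_mem_unitary hA) (traceNorm_nonneg _)
    _ = _ := one_mul _

theorem traceNorm_diagonal (d : Fin m → ℂ) :
    traceNorm (Matrix.diagonal d) = Real.sqrt ((1 / (m : ℝ)) * ∑ i, ‖d i‖ ^ 2) := by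
  rw [traceNorm]
  congr 2
  refine Finset.sum_congr rfl fun i _ => ?_
  rw [Finset.sum_eq_single i] <;> simp +contextual [eq_comm]

theorem normTr_mul_comm (A B : Matrix (Fin m) (Fin m) ℂ) : normTr (A * B) = normTr (B * A) := by
  have := Matrix.trace_mul_comm A B
  simp only [Matrix.trace, Matrix.diag] at this
  rw [normTr, this, normTr]

theorem IsHermitian.exists_unitary_diagonal {H : Matrix (Fin m) (Fin m) ℂ} (hH : H.IsHermitian) :
    ∃ A ∈ unitary (Matrix (Fin m) (Fin m) ℂ), ∃ d : Fin m → ℝ,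
      H = A * Matrix.diagonal (fun i => (d i : ℂ)) * star A := by
  refine ⟨hH.eigenvectorUnitary, hH.eigenvectorUnitary.2, hH.eigenvalues, ?_⟩
  conv_lhs => rw [hH.spectral_theorem, Unitary.conjStarAlgAut_apply]
  rfl

/-- An invertible matrix `X` is at most as far from the unitaries as `X* X` is from `1`. -/
theorem exists_unitary_traceNorm_sub_le {X : Matrix (Fin m) (Fin m) ℂ} (hX : IsUnit X) :
    ∃ U ∈ unitary (Matrix (Fin m) (Fin m) ℂ), traceNorm (X - U) ≤ traceNorm (star X * X - 1) := by
  obtain ⟨A, hA, d, hd⟩ := IsHermitian.exists_unitary_diagonal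
    (H := star X * X) (Matrix.isHermitian_conjTranspose_mul_self X)
  have hA1 := (Unitary.mem_iff.1 hA).1
  have hA2 := (Unitary.mem_iff.1 hA).2
  have hY : star (X * A) * (X * A) = Matrix.diagonal (fun i => (d i : ℂ)) := by
    calc star (X * A) * (X * A) = star A * (star X * X) * A := by simp only [star_mul, mul_assoc]
      _ = (star A * A) * Matrix.diagonal (fun i => (d i : ℂ)) * (star A * A) := by
          rw [hd]; simp only [mul_assoc]
      _ = _ := by rw [hA1]; simp
  have hdi : ∀ i, (d i : ℂ) = ∑ k, ((‖(X * A) k i‖ ^ 2 : ℝ) : ℂ) := by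
    intro i
    have := congrFun (congrFun hY i) i
    rw [Matrix.diagonal_apply_eq, Matrix.mul_apply] at this
    rw [← this]
    refine Finset.sum_congr rfl fun k _ => ?_
    rw [Matrix.star_apply, Complex.star_def, Complex.conj_mul']
    push_cast; rfl
  have hd0 : ∀ i, 0 ≤ d i := by
    intro i
    have h := hdi i
    rw [← Complex.ofReal_sum] at h
    rw [Complex.ofReal_injective h]
    positivity
  have hdu : IsUnit (Matrix.diagonal (fun i => (d i : ℂ))) := by
    rw [← hY]
    have hAu : IsUnit A := ⟨⟨A, star A, hA2, hA1⟩, rfl⟩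
    exact ((hX.mul hAu).star).mul (hX.mul hAu)
  have hdpos : ∀ i, 0 < d i := by
    intro i
    refine (hd0 i).lt_of_ne' fun h => ?_
    rw [Matrix.isUnit_diagonal, Pi.isUnit_iff] at hdu
    simpa [h] using hdu i
  -- With `E` the inverse square root of the diagonal form of `star X * X`, the matrix `X * A * E *
  -- star A` is the unitary polar part of `X`.
  set E : Matrix (Fin m) (Fin m) ℂ := Matrix.diagonal (fun i => ((√(d i))⁻¹ : ℂ)) with hE
  have hEs : star E = E := by
    rw [hE, Matrix.star_eq_conjTranspose, Matrix.diagonal_conjTranspose]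
    congr 1
    funext i
    simp [Complex.conj_ofReal]
  have hsq : ∀ i, (√(d i) : ℂ) * √(d i) = d i := fun i => by
    rw [← Complex.ofReal_mul, Real.mul_self_sqrt (hd0 i)]
  have hs0 : ∀ i, (√(d i) : ℂ) ≠ 0 := fun i => by
    exact_mod_cast (Real.sqrt_pos.2 (hdpos i)).ne'
  have hU1 : star (X * A * E) * (X * A * E) = 1 := by
    calc star (X * A * E) * (X * A * E) = star E * (star (X * A) * (X * A)) * E := by
          simp only [star_mul, mul_assoc]
      _ = 1 := by
          rw [hY, hEs, hE, Matrix.diagonal_mul_diagonal, Matrix.diagonal_mul_diagonal,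
            ← Matrix.diagonal_one]
          congr 1
          funext i
          rw [← hsq]
          have := hs0 i
          field_simp
  have hU : X * A * E ∈ unitary (Matrix (Fin m) (Fin m) ℂ) :=
    Unitary.mem_iff.2 ⟨hU1, mul_eq_one_comm.1 hU1⟩
  refine ⟨X * A * E * star A, mul_mem hU (Unitary.star_mem hA), ?_⟩
  have e1 : X - X * A * E * star A =
      X * A * E * Matrix.diagonal (fun i => (√(d i) : ℂ) - 1) * star A := by
    have : E * Matrix.diagonal (fun i => (√(d i) : ℂ) - 1) = 1 - E := by
      rw [hE, Matrix.diagonal_mul_diagonal, ← Matrix.diagonal_one, Matrix.diagonal_sub]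
      congr 1
      funext i
      have := hs0 i
      field_simp
    rw [mul_assoc (X * A) E (Matrix.diagonal _), this, mul_sub, sub_mul, mul_one,
      mul_assoc X A (star A), hA2, mul_one]
  have e2 : Matrix.diagonal (fun i => (d i : ℂ) - 1) = star A * (star X * X - 1) * A := by
    have : star A * (star X * X - 1) * A = star (X * A) * (X * A) - star A * A := by
      simp only [mul_sub, sub_mul, star_mul, mul_assoc, mul_one]
    rw [this, hY, hA1, ← Matrix.diagonal_one, Matrix.diagonal_sub]
  calc traceNorm (X - X * A * E * star A)
      ≤ traceNorm (Matrix.diagonal (fun i => (√(d i) : ℂ) - 1)) := by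
        rw [e1]; exact traceNorm_unitary_mul_mul_le hU (Unitary.star_mem hA) _
    -- Entrywise `|√d - 1| ≤ |d - 1|`, from `d - 1 = (√d + 1)(√d - 1)`.
    _ ≤ traceNorm (Matrix.diagonal (fun i => (d i : ℂ) - 1)) := by
        rw [traceNorm_diagonal, traceNorm_diagonal]
        apply Real.sqrt_le_sqrt
        gcongr with i _
        rw [← hsq]
        have h : ((√(d i) : ℂ) * √(d i) - 1) = ((√(d i) + 1 : ℝ) : ℂ) * (√(d i) - 1) := by
          push_cast; ring
        rw [h, norm_mul, Complex.norm_real, Real.norm_of_nonneg (by positivity)]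
        exact le_mul_of_one_le_left (norm_nonneg _) (by linarith [Real.sqrt_nonneg (d i)])
    _ ≤ traceNorm (star X * X - 1) := by
        rw [e2]; exact traceNorm_unitary_mul_mul_le (Unitary.star_mem hA) hA _

/-- The spectral theorem for unitary matrices. -/
theorem exists_unitary_diagonal_of_unitary {U : Matrix (Fin m) (Fin m) ℂ}
    (hU : U ∈ unitary (Matrix (Fin m) (Fin m) ℂ)) :
    ∃ A ∈ unitary (Matrix (Fin m) (Fin m) ℂ), ∃ lam : Fin m → ℂ, (∀ i, ‖lam i‖ = 1) ∧
      U = A * Matrix.diagonal lam * star A := by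
  -- Writing `U = exp(iH)` with `H` Hermitian reduces to the Hermitian spectral theorem. The jump of
  -- `arg` is harmless since the spectrum is finite.
  set H : Matrix (Fin m) (Fin m) ℂ := cfc (fun z : ℂ => (Complex.arg z : ℂ)) U with hH
  have hHs : IsSelfAdjoint H := .cfc_arg U
  have hn : IsStarNormal U := ⟨by
    rw [Commute, SemiconjBy, (Unitary.mem_iff.1 hU).1, (Unitary.mem_iff.1 hU).2]⟩
  have hfin : (spectrum ℂ U).Finite := Matrix.finite_spectrum U
  have hUH : U = NormedSpace.exp (Complex.I • H) := by
    rw [← CFC.exp_eq_normedSpace_exp (𝕜 := ℂ), ← cfc_comp_smul .., hH,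
      ← cfc_comp' (hg := (hfin.image _).continuousOn _) (hf := hfin.continuousOn _)]
    conv_lhs => rw [← cfc_id' ℂ U]
    refine cfc_congr fun y hy => ?_
    have hy1 : ‖y‖ = 1 := spectrum.norm_eq_one_of_unitary hU hy
    have := Complex.norm_mul_exp_arg_mul_I y
    rw [hy1, Complex.ofReal_one, one_mul] at this
    simp only [smul_eq_mul, ← Complex.exp_eq_exp_ℂ]
    rw [mul_comm, this]
  obtain ⟨A, hA, d, hd⟩ := IsHermitian.exists_unitary_diagonal (H := H) hHs
  have hA1 := (Unitary.mem_iff.1 hA).1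
  have hA2 := (Unitary.mem_iff.1 hA).2
  refine ⟨A, hA, fun i => Complex.exp (d i * Complex.I), fun i => Complex.norm_exp_ofReal_mul_I _, ?_⟩
  have hinv : A⁻¹ = star A := Matrix.inv_eq_right_inv hA2
  rw [hUH, hd, ← hinv, ← smul_mul_assoc, ← mul_smul_comm, Matrix.exp_conj _ _ ⟨⟨A, star A, hA2, hA1⟩, rfl⟩,
    ← Matrix.diagonal_smul, Matrix.exp_diagonal]
  congr 3
  funext i
  rw [Pi.coe_exp, Complex.exp_eq_exp_ℂ]
  simp [mul_comm]

theorem normTr_conj_diagonal {A : Matrix (Fin m) (Fin m) ℂ}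
    (hA : A ∈ unitary (Matrix (Fin m) (Fin m) ℂ)) (lam : Fin m → ℂ) (j l : ℕ) :
    normTr ((A * Matrix.diagonal lam * star A) ^ j * star (A * Matrix.diagonal lam * star A) ^ l) =
      (1 / (m : ℂ)) * ∑ i, lam i ^ j * star (lam i) ^ l := by
  have hA1 := (Unitary.mem_iff.1 hA).1
  have hA2 := (Unitary.mem_iff.1 hA).2
  have hpow : ∀ (X : Matrix (Fin m) (Fin m) ℂ) (j : ℕ), (A * X * star A) ^ j = A * X ^ j * star A := by
    intro X j
    induction j with
    | zero => simp [hA2]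
    | succ j ih =>
      rw [pow_succ, ih, pow_succ]
      calc _ = A * X ^ j * (star A * A) * X * star A := by simp only [mul_assoc]
        _ = _ := by rw [hA1]; simp only [mul_assoc, one_mul]
  have hstar : star (A * Matrix.diagonal lam * star A) =
      A * Matrix.diagonal (fun i => star (lam i)) * star A := by
    rw [star_mul, star_mul, star_star, mul_assoc, Matrix.star_eq_conjTranspose (Matrix.diagonal lam),
      Matrix.diagonal_conjTranspose]
    rfl
  rw [hstar, hpow, hpow, Matrix.diagonal_pow, Matrix.diagonal_pow]
  have : A * Matrix.diagonal (lam ^ j) * star A *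
      (A * Matrix.diagonal ((fun i => star (lam i)) ^ l) * star A) =
      A * (Matrix.diagonal (fun i => lam i ^ j * star (lam i) ^ l) * star A) := by
    calc _ = A * Matrix.diagonal (lam ^ j) * (star A * A) *
          Matrix.diagonal ((fun i => star (lam i)) ^ l) * star A := by simp only [mul_assoc]
      _ = A * (Matrix.diagonal (lam ^ j) * Matrix.diagonal ((fun i => star (lam i)) ^ l) * star A) := by
          rw [hA1]; simp only [mul_assoc, one_mul]
      _ = _ := by rw [Matrix.diagonal_mul_diagonal]; rfl
  rw [this, normTr_mul_comm, mul_assoc, hA1, mul_one, normTr]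
  simp

/-- Unitary matrices with nearby moments are nearly unitarily conjugate in the trace norm. -/
theorem exists_unitary_traceNorm_sub_conj_le [NeZero m] {U V : Matrix (Fin m) (Fin m) ℂ}
    (hU : U ∈ unitary (Matrix (Fin m) (Fin m) ℂ)) (hV : V ∈ unitary (Matrix (Fin m) (Fin m) ℂ)) :
    ∃ W ∈ unitary (Matrix (Fin m) (Fin m) ℂ), ∀ N : ℕ, N ≠ 0 →
      traceNorm (V - W * U * star W) ≤
        Real.sqrt (16 / N + 4 / N * ∑ j ∈ Finset.range N, ∑ l ∈ Finset.range N,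
          ‖normTr (U ^ j * star U ^ l) - normTr (V ^ j * star V ^ l)‖) := by
  obtain ⟨A, hA, lam, hlam, rfl⟩ := exists_unitary_diagonal_of_unitary hU
  obtain ⟨B, hB, mu, hmu, rfl⟩ := exists_unitary_diagonal_of_unitary hV
  obtain ⟨σ, hσ⟩ := exists_perm_sum_norm_sub_sq_le lam mu hlam hmu
  have hA1 := (Unitary.mem_iff.1 hA).1
  have hA2 := (Unitary.mem_iff.1 hA).2
  set P : Matrix (Fin m) (Fin m) ℂ := σ.permMatrix ℂ with hP
  have hPs : star P = σ⁻¹.permMatrix ℂ := Matrix.conjTranspose_permMatrix σ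
  have hP1 : P * star P = 1 := by
    rw [hPs, hP, ← Matrix.permMatrix_mul]; simp
  have hPm : P ∈ unitary (Matrix (Fin m) (Fin m) ℂ) :=
    Unitary.mem_iff.2 ⟨mul_eq_one_comm.1 hP1, hP1⟩
  have hPd : P * Matrix.diagonal lam * star P = Matrix.diagonal (fun i => lam (σ i)) := by
    have h : P * Matrix.diagonal lam = Matrix.diagonal (fun i => lam (σ i)) * P := by
      ext i j
      rw [Matrix.mul_diagonal, Matrix.diagonal_mul, hP]
      by_cases h : σ i = j
      · subst h; ring
      · simp [PEquiv.toMatrix_apply, Equiv.toPEquiv_apply, h]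
    rw [h, mul_assoc, hP1, mul_one]
  have hm : (m : ℝ) ≠ 0 := by exact_mod_cast NeZero.ne m
  -- `W` carries the eigenbasis of `U` to that of `V`, permuted by the matching `σ`.
  refine ⟨B * P * star A, mul_mem (mul_mem hB hPm) (Unitary.star_mem hA), fun N hN => ?_⟩
  have e : B * Matrix.diagonal mu * star B - B * P * star A * (A * Matrix.diagonal lam * star A) *
      star (B * P * star A) = B * Matrix.diagonal (fun i => mu i - lam (σ i)) * star B := by
    have : B * P * star A * (A * Matrix.diagonal lam * star A) * star (B * P * star A) =
        B * (P * Matrix.diagonal lam * star P) * star B := by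
      calc _ = B * P * (star A * A) * Matrix.diagonal lam * (star A * A) * star P * star B := by
            simp only [star_mul, star_star, mul_assoc]
        _ = _ := by rw [hA1]; simp only [mul_assoc, one_mul]
    rw [this, hPd, ← sub_mul, ← mul_sub, Matrix.diagonal_sub]
  rw [e]
  refine (traceNorm_unitary_mul_mul_le hB (Unitary.star_mem hB) _).trans ?_
  rw [traceNorm_diagonal]
  apply Real.sqrt_le_sqrt
  refine (mul_le_mul_of_nonneg_left (hσ N hN) (by positivity)).trans (le_of_eq ?_)
  simp only [normTr_conj_diagonal hA, normTr_conj_diagonal hB, ← mul_sub, norm_mul, ← Finset.mul_sum]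
  simp only [Fintype.card_fin, norm_div, norm_one, Complex.norm_natCast]
  field_simp

end UnitaryMatrices

theorem traceNorm_le_norm {m : ℕ} (A : Matrix (Fin m) (Fin m) ℂ) : traceNorm A ≤ ‖A‖ := by
  have h : traceNorm (1 : Matrix (Fin m) (Fin m) ℂ) ≤ 1 := by
    rw [← Matrix.diagonal_one, traceNorm_diagonal, Real.sqrt_le_one]
    simpa using inv_mul_le_one (a := (m : ℝ))
  calc traceNorm A = traceNorm (A * 1) := by rw [mul_one]
    _ ≤ ‖A‖ * traceNorm 1 := traceNorm_mul_le _ _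
    _ ≤ ‖A‖ * 1 := mul_le_mul_of_nonneg_left h (norm_nonneg A)
    _ = ‖A‖ := mul_one _

/-- Shift `X` by a small `t > 0` such that `-t` avoids the finite spectrum. The polar part can then
be taken of an invertible matrix. -/
theorem exists_isUnit_norm_sub_le {m : ℕ} (X : Matrix (Fin m) (Fin m) ℂ) {ε : ℝ} (hε : 0 < ε) :
    ∃ Z : Matrix (Fin m) (Fin m) ℂ, IsUnit Z ∧ ‖Z - X‖ ≤ ε := by
  have hfin : ((fun t : ℝ => (-t : ℂ)) ⁻¹' spectrum ℂ X).Finite :=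
    (Matrix.finite_spectrum X).preimage fun a _ b _ h => by simpa using h
  obtain ⟨t, ht, htX⟩ := (Set.Ioo_infinite hε).exists_notMem_finite hfin
  rw [Set.mem_preimage, spectrum.notMem_iff] at htX
  refine ⟨X + algebraMap ℂ _ (t : ℂ), ?_, ?_⟩
  · convert htX.neg using 1
    simp
  · rw [add_sub_cancel_left, Algebra.algebraMap_eq_smul_one, norm_smul, Complex.norm_real,
      Real.norm_of_nonneg ht.1.le]
    exact (mul_le_of_le_one_right ht.1.le
      (norm_le_one_of_mem_unitary (one_mem _))).trans ht.2.le

/-! ### Passage to the ultraproduct. -/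

namespace MatrixUltraproduct

variable (ω : Ultrafilter ℕ) (n : ℕ → ℕ+)

theorem trace_mul_comm (a b : MatrixUltraproduct ω n) : trace ω n (a * b) = trace ω n (b * a) := by
  obtain ⟨x, rfl⟩ := mk_surjective ω n a
  obtain ⟨y, rfl⟩ := mk_surjective ω n b
  rw [← map_mul, ← map_mul]
  refine tendsto_nhds_unique (tendsto_trace ω n (x * y)) ?_
  refine (tendsto_trace ω n (y * x)).congr fun k => ?_
  simp only [lp.infty_coeFn_mul, Pi.mul_apply]
  exact normTr_mul_comm _ _

variable {ω n}

theorem trace_conj_zpow (u w : unitary (MatrixUltraproduct ω n)) (k : ℤ) :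
    trace ω n ((w * u * w⁻¹) ^ k : unitary (MatrixUltraproduct ω n)) =
      trace ω n (u ^ k : unitary (MatrixUltraproduct ω n)) := by
  rw [conj_zpow, Submonoid.coe_mul, trace_mul_comm, ← Submonoid.coe_mul, ← mul_assoc,
    inv_mul_cancel, one_mul]

/-- Mixed moments of a unitary are its integer-power moments, so the trace hypothesis controls every
term of the finite-dimensional bound. -/
theorem coe_zpow_sub (u : unitary (MatrixUltraproduct ω n)) (j l : ℕ) :
    ((u ^ ((j : ℤ) - l) : unitary (MatrixUltraproduct ω n)) : MatrixUltraproduct ω n) =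
      (u : MatrixUltraproduct ω n) ^ j * star (u : MatrixUltraproduct ω n) ^ l := by
  rw [zpow_sub, zpow_natCast, zpow_natCast, ← inv_pow, ← Unitary.star_eq_inv]
  simp

/-- Every unitary of the ultraproduct is the class of a sequence of unitary matrices. -/
theorem exists_unitary_lift (hω : (ω : Filter ℕ) ≤ cofinite)
    (u : unitary (MatrixUltraproduct ω n)) :
    ∃ x : BoundedSeq n, (∀ k, x k ∈ unitary (Matrix (Fin (n k)) (Fin (n k)) ℂ)) ∧
      mk ω n x = u := by
  obtain ⟨y, hy⟩ := mk_surjective ω n (u : MatrixUltraproduct ω n)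
  -- The error `1 / (k + 1)` vanishes along `ω` because `ω` is free, so `Z` represents the same
  -- class as `y`.
  choose Z hZu hZ using fun k : ℕ =>
    exists_isUnit_norm_sub_le (y k) (Nat.one_div_pos_of_nat (α := ℝ) (n := k))
  have hlim : Tendsto (fun k : ℕ => 1 / ((k : ℝ) + 1)) (ω : Filter ℕ) (𝓝 0) :=
    tendsto_one_div_add_atTop_nhds_zero_nat.mono_left (Nat.cofinite_eq_atTop ▸ hω)
  let z : BoundedSeq n := ⟨Z, memℓp_infty ⟨‖y‖ + 1, by
    rintro _ ⟨k, rfl⟩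
    have h1 : ‖y k‖ ≤ ‖y‖ := lp.norm_apply_le_norm (by simp) y k
    have h2 : 1 / ((k : ℝ) + 1) ≤ 1 := by
      rw [div_le_one (by positivity)]; linarith [(Nat.cast_nonneg k : (0 : ℝ) ≤ k)]
    have h3 : ‖Z k‖ ≤ ‖Z k - y k‖ + ‖y k‖ := by simpa using norm_add_le (Z k - y k) (y k)
    linarith [hZ k]⟩⟩
  have hz : mk ω n z = u := by
    rw [← hy, mk_eq_mk, mem_nullIdeal]
    exact squeeze_zero (fun k => traceNorm_nonneg _)
      (fun k => (traceNorm_le_norm _).trans (hZ k)) hlim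
  have hz1 : star z * z - 1 ∈ nullIdeal ω n := by
    rw [← mk_eq_mk, map_mul, ← star_mk, hz, map_one]
    exact Unitary.coe_star_mul_self u
  -- Since `u` is unitary, `star z * z - 1` is null, and this bounds the distance from `z` to its
  -- polar parts.
  choose U hU hUZ using fun k => exists_unitary_traceNorm_sub_le (hZu k)
  let x : BoundedSeq n := ⟨U, memℓp_infty ⟨1, by
    rintro _ ⟨k, rfl⟩
    exact norm_le_one_of_mem_unitary (hU k)⟩⟩
  refine ⟨x, hU, ?_⟩
  rw [← hz, eq_comm, mk_eq_mk, mem_nullIdeal]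
  exact squeeze_zero (fun k => traceNorm_nonneg _) hUZ hz1

theorem tendsto_normTr_pow_mul_star_pow {x : BoundedSeq n} {u : unitary (MatrixUltraproduct ω n)}
    (hx : mk ω n x = u) (j l : ℕ) :
    Tendsto (fun k => normTr (x k ^ j * star (x k) ^ l)) (ω : Filter ℕ)
      (𝓝 (trace ω n (u ^ ((j : ℤ) - l) : unitary (MatrixUltraproduct ω n)))) := by
  have h := tendsto_trace ω n (x ^ j * star x ^ l)
  rw [map_mul, map_pow, map_pow, ← star_mk, hx, ← coe_zpow_sub] at h
  refine h.congr fun k => ?_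
  simp only [lp.infty_coeFn_mul, lp.infty_coeFn_pow, lp.coeFn_star, Pi.mul_apply, Pi.pow_apply,
    Pi.star_apply]

theorem exists_unitary_conj_of_trace_zpow_eq (hω : (ω : Filter ℕ) ≤ cofinite)
    (u v : unitary (MatrixUltraproduct ω n))
    (h : ∀ k : ℤ, trace ω n (u ^ k : unitary (MatrixUltraproduct ω n)) =
      trace ω n (v ^ k : unitary (MatrixUltraproduct ω n))) :
    ∃ w : unitary (MatrixUltraproduct ω n), (v : MatrixUltraproduct ω n) =
      w * u * star (w : MatrixUltraproduct ω n) := by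
  obtain ⟨x, hxU, hx⟩ := exists_unitary_lift hω u
  obtain ⟨y, hyU, hy⟩ := exists_unitary_lift hω v
  choose W hW hWle using fun k => exists_unitary_traceNorm_sub_conj_le (hxU k) (hyU k)
  let w : BoundedSeq n := ⟨W, memℓp_infty ⟨1, by
    rintro _ ⟨k, rfl⟩
    exact norm_le_one_of_mem_unitary (hW k)⟩⟩
  have hw1 : star w * w = 1 := by
    ext1; funext k; exact (Unitary.mem_iff.1 (hW k)).1
  have hw2 : w * star w = 1 := by
    ext1; funext k; exact (Unitary.mem_iff.1 (hW k)).2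
  have hw : mk ω n w ∈ unitary (MatrixUltraproduct ω n) := by
    rw [Unitary.mem_iff, star_mk, ← map_mul, ← map_mul, hw1, hw2, map_one]
    exact ⟨rfl, rfl⟩
  refine ⟨⟨mk ω n w, hw⟩, ?_⟩
  rw [← hx, ← hy, star_mk, ← map_mul, ← map_mul, mk_eq_mk, mem_nullIdeal]
  have hbound : ∀ N : ℕ, Tendsto (fun k => Real.sqrt (16 / N + 4 / N * ∑ j ∈ Finset.range N,
      ∑ l ∈ Finset.range N, ‖normTr (x k ^ j * star (x k) ^ l) -
        normTr (y k ^ j * star (y k) ^ l)‖)) (ω : Filter ℕ) (𝓝 (Real.sqrt (16 / N))) := by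
    intro N
    have hs : Tendsto (fun k => ∑ j ∈ Finset.range N, ∑ l ∈ Finset.range N,
        ‖normTr (x k ^ j * star (x k) ^ l) - normTr (y k ^ j * star (y k) ^ l)‖)
        (ω : Filter ℕ) (𝓝 (∑ j ∈ Finset.range N, ∑ l ∈ Finset.range N, (0 : ℝ))) := by
      refine tendsto_finsetSum _ fun j _ => tendsto_finsetSum _ fun l _ => ?_
      have := ((tendsto_normTr_pow_mul_star_pow hx j l).sub
        (tendsto_normTr_pow_mul_star_pow hy j l)).norm
      rwa [h, sub_self, norm_zero] at this
    have := ((hs.const_mul (4 / (N : ℝ))).const_add (16 / (N : ℝ))).sqrt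
    simpa using this
  have hsmall : Tendsto (fun N : ℕ => Real.sqrt (16 / N)) atTop (𝓝 0) := by
    simpa using (tendsto_const_div_atTop_nhds_zero_nat (16 : ℝ)).sqrt
  -- Given `ε`, fix `N` with `√(16 / N) < ε`; then `ω`-almost every `k` satisfies the bound for this
  -- `N`, with the same `W k` throughout.
  rw [Metric.tendsto_nhds]
  intro ε hε
  obtain ⟨N, hNε, hN⟩ := ((hsmall.eventually_lt_const hε).and (eventually_ne_atTop 0)).exists
  filter_upwards [(hbound N).eventually_lt_const hNε] with k hk
  rw [Real.dist_eq, sub_zero, abs_of_nonneg (traceNorm_nonneg _)]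
  exact (hWle k N hN).trans_lt hk

end MatrixUltraproduct
end

end MatUltra

theorem mainTheorem3 (ω : Ultrafilter ℕ) (hω : (ω : Filter ℕ) ≤ Filter.cofinite)
    (n : ℕ → ℕ+) (hn : Filter.Tendsto (fun k => (n k : ℕ)) Filter.atTop Filter.atTop)
    (u v : unitary (MatUltra.MatrixUltraproduct ω n)) :
    (∃ w : unitary (MatUltra.MatrixUltraproduct ω n),
        (v : MatUltra.MatrixUltraproduct ω n) = w * u * star (w : MatUltra.MatrixUltraproduct ω n)) ↔
      ∀ k : ℤ,
        MatUltra.MatrixUltraproduct.trace ω n ((u ^ k : unitary (MatUltra.MatrixUltraproduct ω n)) :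
            MatUltra.MatrixUltraproduct ω n) =
          MatUltra.MatrixUltraproduct.trace ω n ((v ^ k : unitary (MatUltra.MatrixUltraproduct ω n)) :
            MatUltra.MatrixUltraproduct ω n) := by
  refine ⟨?_, MatUltra.MatrixUltraproduct.exists_unitary_conj_of_trace_zpow_eq hω u v⟩
  rintro ⟨w, hw⟩ k
  obtain rfl : v = w * u * w⁻¹ := Subtype.ext hw
  exact (MatUltra.MatrixUltraproduct.trace_conj_zpow u w k).symm
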